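/- Let $A$ be a finite alphabet and let $\mu : A \to (0,1]$ satisfy $\sum_{a\in A}\mu(a)=1$ (that is, $\mu$ induces a positive Bernoulli measure on $A^\omega$); for a word $w=a_1\cdots a_k$ put $\mu(w)=\prod_{j=1}^k\mu(a_j)$. A sequence $X=X(0)X(1)\cdots\in A^\omega$ is called $\mu$-normal if for every word $w\in A^*$, with $k=|w|$, $$\lim_{n\to\infty}\frac{\#\{i : 0\le i\le n-k,\ X(i)\cdots X(i+k-1)=w\}}{n-k+1}=\mu(w).$$ A $\mu$-gambler $\mathcal G=(Q,A,q_I,\delta,\gamma)$ consists of a finite set $Q$ of states, an initial state $q_I\in Q$, a transition function $\delta:Q\times A\to Q$, and a betting function $\gamma:Q\times A\to[0,\infty)$ such that $\sum_{a\in A}\mu(a)\gamma(q,a)=1$ for every $q\in Q$. Its capital after the first $n$ letters of $X$ is $c_n=\prod_{i=0}^{n-1}\gamma(q_i,X(i))$, where $q_0=q_I$ and $q_{i+1}=\delta(q_i,X(i))$. Theorem (Schnorr-Stimm dichotomy theorem for Bernoulli measures). Let $X\in A^\omega$. (i) If $X$ is $\mu$-normal, then for every $\mu$-gambler the capital $(c_n)$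 on $X$ is either ultimately constant or decreases at an exponential rate, i.e. there are constants $C$ and $0<\rho<1$ with $c_n\le C\rho^n$ for all $n$. (ii) If $X$ is not $\mu$-normal, then there is a $\mu$-gambler which wins against $X$, i.e. $\limsup_{n\to\infty} c_n=+\infty$, and does so at an infinitely-often exponential rate, i.e. $$\limsup_{n\to\infty}\frac{\log c_n}{n}>0\qquad(\text{with } \log 0=-\infty).$$ -/

import Mathlib

open scoped NNReal ENNReal

namespace SchnorrStimm

/-- The word formed by the first `n` letters of the infinite sequence `X`. -/
def firstLetters {A : Type*} (X : ℕ → A) (n : ℕ) : List A :=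
  (List.range n).map X

/-- Number of (possibly overlapping) occurrences of the word `u` in the word `w`: the number of
positions `i` with `0 ≤ i ≤ |w| - |u|` at which `u` is read in `w`. It is `0` if `|w| < |u|`. -/
def nbocc {A : Type*} [DecidableEq A] (u w : List A) : ℕ :=
  ((Finset.range (w.length + 1 - u.length)).filter
    (fun i => (w.drop i).take u.length = u)).card

/-- Frequency of occurrence of `u` in `w`, meaningful when `|u| ≤ |w|`. -/
noncomputable def freq {A : Type*} [DecidableEq A] (u w : List A) : ℝ :=
  (nbocc u w : ℝ) / ((w.length : ℝ) - (u.length : ℝ) + 1)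

/-- The Bernoulli weight `μ(w) = ∏ⱼ μ(wⱼ)` of a finite word. -/
def wordWeight {A : Type*} (μ : A → ℝ) (w : List A) : ℝ :=
  (w.map μ).prod

/-- `X` is `μ`-normal: every finite word `w` occurs in `X` with limiting frequency `μ(w)`. -/
def IsNormal {A : Type*} [DecidableEq A] (μ : A → ℝ) (X : ℕ → A) : Prop :=
  ∀ w : List A,
    Filter.Tendsto (fun n : ℕ => freq w (firstLetters X n)) Filter.atTop
      (nhds (wordWeight μ w))

/-- A `μ`-gambler over the alphabet `A` with state set `Q`: a deterministic automaton
together with a betting function that is fair with respect to `μ` in every state.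
Finiteness of `Q` is required where gamblers are quantified over. -/
structure Gambler (A Q : Type*) [Fintype A] (μ : A → ℝ) where
  init : Q
  step : Q → A → Q
  bet : Q → A → ℝ≥0
  fair : ∀ q : Q, ∑ a : A, μ a * (bet q a : ℝ) = 1

namespace Gambler

variable {A Q : Type*} [Fintype A] {μ : A → ℝ}

/-- The extended transition function: the state reached from `q` after reading a word. -/
def run (G : Gambler A Q μ) (q : Q) (w : List A) : Q :=
  w.foldl G.step q

/-- The factor by which the capital is multiplied when a word is read from the state `q`. -/
def capitalFrom (G : Gambler A Q μ) : Q → List A → ℝ≥0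
  | _, [] => 1
  | q, a :: w => G.bet q a * capitalFrom G (G.step q a) w

/-- The capital of the gambler after betting on the word `w`, starting with capital `1`. -/
def capital (G : Gambler A Q μ) (w : List A) : ℝ≥0 :=
  G.capitalFrom G.init w

theorem capital_nil (G : Gambler A Q μ) : G.capital [] = 1 := rfl

theorem capitalFrom_append_singleton (G : Gambler A Q μ) (q : Q) (w : List A) (a : A) :
    G.capitalFrom q (w ++ [a]) = G.capitalFrom q w * G.bet (G.run q w) a := by
  induction w generalizing q with
  | nil => simp [capitalFrom, run]
  | cons b w ih =>
    simp only [List.cons_append, capitalFrom, ih, run, List.foldl_cons, mul_assoc]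

theorem capital_append_singleton (G : Gambler A Q μ) (w : List A) (a : A) :
    G.capital (w ++ [a]) = G.capital w * G.bet (G.run G.init w) a :=
  G.capitalFrom_append_singleton G.init w a

/-- The gambler wins against `X`: the upper limit of her capital is infinite. -/
def Wins (G : Gambler A Q μ) (X : ℕ → A) : Prop :=
  Filter.limsup (fun n : ℕ => (G.capital (firstLetters X n) : ℝ≥0∞)) Filter.atTop = ⊤

/-- `limsup (log capital) / n > 0`, computed in the extended reals with `log 0 = -∞`. -/
def HasIOExponentialRate (G : Gambler A Q μ) (X : ℕ → A) : Prop :=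
  0 < Filter.limsup
    (fun n : ℕ => ENNReal.log (G.capital (firstLetters X n) : ℝ≥0∞) / ((n : ℝ) : EReal))
    Filter.atTop

/-- The capital does not change any more from some time on. -/
def CapitalUltimatelyConstant (G : Gambler A Q μ) (X : ℕ → A) : Prop :=
  ∃ N : ℕ, ∀ n : ℕ, N ≤ n → G.capital (firstLetters X n) = G.capital (firstLetters X N)

/-- The capital decreases at an exponential rate: it is at most `C * ρ ^ n` after `n` letters,
for some constants `C` and `0 < ρ < 1`. -/
def CapitalDecreasesExponentially (G : Gambler A Q μ) (X : ℕ → A) : Prop :=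
  ∃ C ρ : ℝ, 0 < ρ ∧ ρ < 1 ∧
    ∀ n : ℕ, (G.capital (firstLetters X n) : ℝ) ≤ C * ρ ^ n

end Gambler

end SchnorrStimm

/-! For a normal sequence, follow the square root of the capital. By AM-GM, `∑ a, μ a * √(bet q a) ≤
1`, with equality only when every bet at `q` is 1. Killing the root on idle states gives
expectations `meanActiveRoot n q` that decrease in `n`; a maximum principle on the finite state set
forces their limit to be 0 (`tendsto_meanActiveRoot`). Fix `m` for which their sum over all states
is below 1. Since `log x ≤ x - 1`, the logarithm of the root grows over `m` letters by at most a
function of the window read, and normality gives this function a negative average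
(`exists_le_sub_mul_of_average`).

For a sequence that is not normal, some `u` has the right frequency while some `u ++ [a]` has not.
Betting a small `ε` for or against `a` after each `u` gains to first order `ε` times the excess of
`u ++ [a]`, which is linear in `n` infinitely often, and loses only `O(ε ^ 2 * n)`
(`le_log_capital_wordBettor`). -/

namespace SchnorrStimm

/-! ### Occurrences of words and window averages -/

section Words

variable {A : Type*}

theorem firstLetters_length (X : ℕ → A) (n : ℕ) : (firstLetters X n).length = n := by
  simp [firstLetters]

theorem firstLetters_succ (X : ℕ → A) (n : ℕ) :
    firstLetters X (n + 1) = firstLetters X n ++ [X n] := by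
  simp [firstLetters, List.range_succ]

theorem firstLetters_add (X : ℕ → A) (n m : ℕ) :
    firstLetters X (n + m) = firstLetters X n ++ firstLetters (fun j => X (n + j)) m := by
  simp [firstLetters, List.range_add, Function.comp_def]

theorem firstLetters_eq_ofFn (X : ℕ → A) (n : ℕ) :
    firstLetters X n = List.ofFn (fun j : Fin n => X j) := by
  apply List.ext_getElem <;> simp [firstLetters]

theorem take_drop_firstLetters (X : ℕ → A) {i m n : ℕ} (h : i + m ≤ n) :
    ((firstLetters X n).drop i).take m = firstLetters (fun j => X (i + j)) m := by
  obtain ⟨r, rfl⟩ := Nat.exists_eq_add_of_le h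
  rw [firstLetters_add X (i + m) r, firstLetters_add X i m, List.append_assoc,
    List.drop_left' (firstLetters_length X i), List.take_left' (firstLetters_length _ m)]

theorem wordWeight_cons (μ : A → ℝ) (a : A) (w : List A) :
    wordWeight μ (a :: w) = μ a * wordWeight μ w := by
  simp [wordWeight]

theorem wordWeight_append_singleton (μ : A → ℝ) (w : List A) (a : A) :
    wordWeight μ (w ++ [a]) = wordWeight μ w * μ a := by
  simp [wordWeight]

theorem append_singleton_suffix_append_singleton {u l : List A} {a b : A} :
    u ++ [a] <:+ l ++ [b] ↔ a = b ∧ u <:+ l := by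
  rw [← List.reverse_prefix, ← List.reverse_prefix]
  simp [List.cons_prefix_cons]

theorem rtake_length_eq_iff {u l : List A} : l.rtake u.length = u ↔ u <:+ l := by
  rw [List.rtake, List.suffix_iff_eq_drop, eq_comm]

variable [DecidableEq A]

theorem nbocc_nil (u : List A) : nbocc u [] = if u = [] then 1 else 0 := by
  cases u <;> simp [nbocc]

/-- The only new occurrence is one that ends at the last letter, so counting reduces to the suffix
relation. -/
theorem nbocc_append_singleton (u l : List A) (b : A) :
    nbocc u (l ++ [b]) = nbocc u l + if u <:+ l ++ [b] then 1 else 0 := by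
  unfold nbocc
  by_cases h : u.length ≤ l.length + 1
  · obtain ⟨m, hm⟩ := Nat.exists_eq_add_of_le h
    have e1 : (l ++ [b]).length + 1 - u.length = m + 1 := by simp; omega
    have e2 : l.length + 1 - u.length = m := by omega
    rw [e1, e2, Finset.range_add_one, Finset.filter_insert]
    have hlast : ((l ++ [b]).drop m).take u.length = u ↔ u <:+ l ++ [b] := by
      rw [List.take_of_length_le (by simp; omega), List.suffix_iff_eq_drop]
      have : (l ++ [b]).length - u.length = m := by simp; omega
      rw [this, eq_comm]
    have hfil : (Finset.range m).filter (fun i => ((l ++ [b]).drop i).take u.length = u) =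
        (Finset.range m).filter (fun i => (l.drop i).take u.length = u) := by
      apply Finset.filter_congr
      intro i hi
      have hi := Finset.mem_range.1 hi
      rw [List.drop_append_of_le_length (by omega),
        List.take_append_of_le_length (by simp; omega)]
    rw [hfil]
    by_cases hs : u <:+ l ++ [b]
    · rw [if_pos (hlast.2 hs), if_pos hs, Finset.card_insert_of_notMem (by simp)]
    · rw [if_neg (fun h => hs (hlast.1 h)), if_neg hs, add_zero]
  · have e1 : (l ++ [b]).length + 1 - u.length = 0 := by simp; omega
    have e2 : l.length + 1 - u.length = 0 := by omega
    have hs : ¬ u <:+ l ++ [b] := fun hs => h (by simpa using hs.length_le)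
    rw [e1, e2]
    simp [hs]

theorem tendsto_freq_iff (X : ℕ → A) (w : List A) (c : ℝ) :
    Filter.Tendsto (fun n : ℕ => freq w (firstLetters X n)) Filter.atTop (nhds c) ↔
      Filter.Tendsto (fun n : ℕ => (nbocc w (firstLetters X n) : ℝ) / n)
        Filter.atTop (nhds c) := by
  have hr : Filter.Tendsto (fun n : ℕ => ((n : ℝ) - w.length + 1) / n) Filter.atTop (nhds 1) := by
    have h := (tendsto_const_div_atTop_nhds_zero_nat (1 - (w.length : ℝ))).const_add 1
    rw [add_zero] at h
    refine h.congr' ?_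
    filter_upwards [Filter.eventually_gt_atTop 0] with n hn
    have : (n : ℝ) ≠ 0 := by positivity
    field_simp
    ring
  have hr' := hr.inv₀ one_ne_zero
  have hne : ∀ᶠ n : ℕ in Filter.atTop, (n : ℝ) ≠ 0 ∧ (n : ℝ) - w.length + 1 ≠ 0 := by
    filter_upwards [Filter.eventually_gt_atTop w.length] with n hn
    have h1 : (w.length : ℝ) < n := by exact_mod_cast hn
    have h2 : (0 : ℝ) ≤ w.length := by positivity
    exact ⟨by linarith, by linarith⟩
  constructor
  · intro h
    have h2 := h.mul hr
    rw [mul_one] at h2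
    refine h2.congr' ?_
    filter_upwards [hne] with n hn
    obtain ⟨h3, h4⟩ := hn
    simp only [freq, firstLetters_length]
    field_simp
  · intro h
    have h2 := h.mul hr'
    rw [inv_one, mul_one] at h2
    refine h2.congr' ?_
    filter_upwards [hne] with n hn
    obtain ⟨h3, h4⟩ := hn
    simp only [freq, firstLetters_length]
    field_simp

/-- In a normal sequence the averages of a function of the windows of a given length converge to
its expectation. -/
theorem IsNormal.tendsto_average [Fintype A] {μ : A → ℝ} {X : ℕ → A} (hX : IsNormal μ X) (m : ℕ)
    (f : List A → ℝ) :
    Filter.Tendsto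
      (fun n : ℕ => (∑ i ∈ Finset.range n, f (firstLetters (fun j => X (i + j)) m)) / (n : ℝ))
      Filter.atTop
      (nhds (∑ v : Fin m → A, wordWeight μ (List.ofFn v) * f (List.ofFn v))) := by
  -- The first `n + m` letters contain exactly `n + 1` windows of length `m`, hence the shift.
  rw [← Filter.tendsto_add_atTop_iff_nat 1]
  have h : Filter.Tendsto (fun n : ℕ => ∑ v : Fin m → A,
      freq (List.ofFn v) (firstLetters X (n + m)) * f (List.ofFn v)) Filter.atTop
      (nhds (∑ v : Fin m → A, wordWeight μ (List.ofFn v) * f (List.ofFn v))) :=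
    tendsto_finsetSum _ fun v _ =>
      ((Filter.tendsto_add_atTop_iff_nat m).2 (hX (List.ofFn v))).mul_const _
  refine h.congr fun n => ?_
  have hfreq : ∀ v : Fin m → A, freq (List.ofFn v) (firstLetters X (n + m)) =
      (∑ i ∈ Finset.range (n + 1),
        if firstLetters (fun j => X (i + j)) m = List.ofFn v then (1 : ℝ) else 0) /
        ((n + 1 : ℕ) : ℝ) := by
    intro v
    have e1 : n + m + 1 - m = n + 1 := by omega
    rw [freq, nbocc, firstLetters_length, List.length_ofFn, e1, Finset.sum_boole]
    congr 2
    · congr 1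
      apply Finset.filter_congr
      intro i hi
      have hi := Finset.mem_range.1 hi
      rw [take_drop_firstLetters X (by omega)]
    · push_cast
      ring
  simp_rw [hfreq, div_mul_eq_mul_div, ← Finset.sum_div, Finset.sum_mul]
  congr 1
  rw [Finset.sum_comm]
  refine Finset.sum_congr rfl fun i _ => ?_
  rw [firstLetters_eq_ofFn]
  simp only [List.ofFn_inj, ite_mul, one_mul, zero_mul, Finset.sum_ite_eq, Finset.mem_univ,
    if_true]

end Words

/-! ### Decay of the expected square root of the capital -/

namespace Gambler

section Decrease

variable {A Q : Type*} [Fintype A] {μ : A → ℝ} (G : Gambler A Q μ)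

theorem capitalFrom_append (q : Q) (v w : List A) :
    G.capitalFrom q (v ++ w) = G.capitalFrom q v * G.capitalFrom (G.run q v) w := by
  induction v generalizing q with
  | nil => simp [capitalFrom, run]
  | cons b v ih => simp only [List.cons_append, capitalFrom, ih, run, List.foldl_cons, mul_assoc]

/-- No nontrivial bet is placed any more from the state `q` on. -/
def Idle (q : Q) : Prop := ∀ w : List A, G.capitalFrom q w = 1

variable {G}

theorem Idle.run {q : Q} (h : G.Idle q) (v : List A) : G.Idle (G.run q v) := fun w => by
  have := h (v ++ w)
  rwa [capitalFrom_append, h v, one_mul] at this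

variable (G)

theorem sum_mul_sqrt_bet_le (hpos : ∀ a, 0 < μ a) (hsum : ∑ a, μ a = 1) (q : Q) :
    ∑ a, μ a * √(G.bet q a : ℝ) ≤ 1 := by
  have h : ∀ a, μ a * √(G.bet q a : ℝ) ≤ (μ a + μ a * G.bet q a) / 2 := fun a => by
    have h1 : √(G.bet q a : ℝ) ≤ (1 + G.bet q a) / 2 := by
      nlinarith [sq_nonneg (√(G.bet q a : ℝ) - 1), Real.sq_sqrt (G.bet q a).coe_nonneg]
    nlinarith [hpos a]
  refine (Finset.sum_le_sum fun a _ => h a).trans ?_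
  rw [← Finset.sum_div, Finset.sum_add_distrib, hsum, G.fair]
  norm_num

/-- Equality case of AM-GM: the weighted sum of the squares `(√bet - 1) ^ 2` vanishes. -/
theorem bet_eq_one_of_sum_mul_sqrt_bet (hpos : ∀ a, 0 < μ a) (hsum : ∑ a, μ a = 1) {q : Q}
    (hq : ∑ a, μ a * √(G.bet q a : ℝ) = 1) (a : A) : G.bet q a = 1 := by
  have h0 : ∑ a, μ a * (√(G.bet q a : ℝ) - 1) ^ 2 = 0 := by
    have h1 : ∀ a, μ a * (√(G.bet q a : ℝ) - 1) ^ 2 =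
        μ a * G.bet q a - 2 * (μ a * √(G.bet q a : ℝ)) + μ a := fun a => by
      rw [sub_sq, Real.sq_sqrt (G.bet q a).coe_nonneg]
      ring
    simp_rw [h1]
    rw [Finset.sum_add_distrib, Finset.sum_sub_distrib, ← Finset.mul_sum, hq, hsum, G.fair]
    norm_num
  have h2 := (Finset.sum_eq_zero_iff_of_nonneg
    (fun a _ => mul_nonneg (hpos a).le (sq_nonneg _))).1 h0 a (Finset.mem_univ a)
  have h3 : √(G.bet q a : ℝ) = 1 := by
    have := (mul_eq_zero.1 h2).resolve_left (hpos a).ne'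
    have := pow_eq_zero_iff (two_ne_zero) |>.1 this
    linarith
  have h4 : (G.bet q a : ℝ) = 1 := by simpa using h3
  exact_mod_cast h4

open scoped Classical in
/-- The square root of the capital gained along the word `w`, set to `0` on the words leading
to an idle state. -/
noncomputable def activeRoot (q : Q) (w : List A) : ℝ :=
  if G.Idle (G.run q w) then 0 else √(G.capitalFrom q w : ℝ)

theorem activeRoot_nonneg (q : Q) (w : List A) : 0 ≤ G.activeRoot q w := by
  unfold activeRoot
  split_ifs <;> positivity

theorem activeRoot_cons (q : Q) (a : A) (w : List A) :
    G.activeRoot q (a :: w) = √(G.bet q a : ℝ) * G.activeRoot (G.step q a) w := by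
  have hrun : G.run q (a :: w) = G.run (G.step q a) w := rfl
  by_cases h : G.Idle (G.run (G.step q a) w)
  · rw [activeRoot, activeRoot, hrun, if_pos h, if_pos h, mul_zero]
  · rw [activeRoot, activeRoot, hrun, if_neg h, if_neg h, capitalFrom, NNReal.coe_mul,
      Real.sqrt_mul (G.bet q a).coe_nonneg]

/-- The expectation of `activeRoot` over the words of length `n`. -/
noncomputable def meanActiveRoot (n : ℕ) (q : Q) : ℝ :=
  ∑ v : Fin n → A, wordWeight μ (List.ofFn v) * G.activeRoot q (List.ofFn v)

theorem meanActiveRoot_zero (q : Q) : G.meanActiveRoot 0 q = G.activeRoot q [] := by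
  simp [meanActiveRoot, wordWeight]

theorem meanActiveRoot_succ (n : ℕ) (q : Q) :
    G.meanActiveRoot (n + 1) q =
      ∑ a, μ a * √(G.bet q a : ℝ) * G.meanActiveRoot n (G.step q a) := by
  unfold meanActiveRoot
  rw [← (Fin.consEquiv (fun _ : Fin (n + 1) => A)).sum_comp, Fintype.sum_prod_type]
  refine Finset.sum_congr rfl fun a _ => ?_
  rw [Finset.mul_sum]
  refine Finset.sum_congr rfl fun v _ => ?_
  simp only [Fin.consEquiv_apply, List.ofFn_succ, Fin.cons_zero, Fin.cons_succ, wordWeight_cons,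
    activeRoot_cons]
  ring

theorem meanActiveRoot_nonneg (hpos : ∀ a, 0 < μ a) (n : ℕ) (q : Q) :
    0 ≤ G.meanActiveRoot n q := by
  induction n generalizing q with
  | zero => rw [meanActiveRoot_zero]; exact G.activeRoot_nonneg _ _
  | succ n ih =>
    rw [meanActiveRoot_succ]
    exact Finset.sum_nonneg fun a _ =>
      mul_nonneg (mul_nonneg (hpos a).le (Real.sqrt_nonneg _)) (ih _)

theorem meanActiveRoot_of_idle {q : Q} (hq : G.Idle q) (n : ℕ) : G.meanActiveRoot n q = 0 := by
  refine Finset.sum_eq_zero fun v _ => ?_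
  rw [activeRoot, if_pos (hq.run _), mul_zero]

/-- The recursion in `n` has nonnegative coefficients, so only the step from 0 to 1 needs the square
root inequality. -/
theorem meanActiveRoot_antitone (hpos : ∀ a, 0 < μ a) (hsum : ∑ a, μ a = 1) (q : Q) :
    Antitone fun n => G.meanActiveRoot n q := by
  refine antitone_nat_of_succ_le fun n => ?_
  induction n generalizing q with
  | zero =>
    by_cases hq : G.Idle q
    · simp [G.meanActiveRoot_of_idle hq]
    · rw [meanActiveRoot_succ]
      have h1 : G.meanActiveRoot 0 q = 1 := by
        rw [meanActiveRoot_zero, activeRoot, if_neg (by exact hq)]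
        simp [capitalFrom]
      rw [h1]
      refine (Finset.sum_le_sum fun a _ => ?_).trans (G.sum_mul_sqrt_bet_le hpos hsum q)
      refine mul_le_of_le_one_right (mul_nonneg (hpos a).le (Real.sqrt_nonneg _)) ?_
      rw [meanActiveRoot_zero, activeRoot]
      split_ifs <;> simp [capitalFrom]
  | succ n ih =>
    rw [meanActiveRoot_succ, meanActiveRoot_succ]
    exact Finset.sum_le_sum fun a _ =>
      mul_le_mul_of_nonneg_left (ih _) (mul_nonneg (hpos a).le (Real.sqrt_nonneg _))

/-- The limit `φ` is a fixed point of the recursion. If its maximum were positive, a state attaining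
it would be idle, but `φ` is 0 on idle states. -/
theorem tendsto_meanActiveRoot [Finite Q] (hpos : ∀ a, 0 < μ a) (hsum : ∑ a, μ a = 1) (q : Q) :
    Filter.Tendsto (fun n => G.meanActiveRoot n q) Filter.atTop (nhds 0) := by
  have hlim : ∀ q, ∃ x, Filter.Tendsto (fun n => G.meanActiveRoot n q) Filter.atTop (nhds x) :=
    fun q => ⟨_, tendsto_atTop_ciInf (G.meanActiveRoot_antitone hpos hsum q)
      ⟨0, by rintro _ ⟨n, rfl⟩; exact G.meanActiveRoot_nonneg hpos n q⟩⟩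
  choose φ hφ using hlim
  have hrec : ∀ q, φ q = ∑ a, μ a * √(G.bet q a : ℝ) * φ (G.step q a) := fun q => by
    refine tendsto_nhds_unique ((Filter.tendsto_add_atTop_iff_nat 1).2 (hφ q)) ?_
    simp_rw [meanActiveRoot_succ]
    exact tendsto_finsetSum _ fun a _ => (hφ _).const_mul _
  have hnonneg : ∀ q, 0 ≤ φ q := fun q =>
    ge_of_tendsto' (hφ q) fun n => G.meanActiveRoot_nonneg hpos n q
  have : Nonempty Q := ⟨q⟩
  obtain ⟨p, hp⟩ := Finite.exists_max φ
  have hp0 : φ p = 0 := by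
    by_contra hne
    have hppos : 0 < φ p := lt_of_le_of_ne (hnonneg p) (Ne.symm hne)
    -- Maximum principle: at a maximal state the root inequality is an equality, and a weighted mean
    -- of values at most `φ p` equals `φ p`.
    have hmax : ∀ r, φ r = φ p → ∀ a, G.bet r a = 1 ∧ φ (G.step r a) = φ p := by
      intro r hr
      have hle : φ p ≤ ∑ a, μ a * √(G.bet r a : ℝ) * φ p := by
        rw [← hr]
        nth_rewrite 1 [hrec r]
        rw [hr]
        exact Finset.sum_le_sum fun a _ =>
          mul_le_mul_of_nonneg_left (hp _) (mul_nonneg (hpos a).le (Real.sqrt_nonneg _))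
      rw [← Finset.sum_mul] at hle
      have hone : ∑ a, μ a * √(G.bet r a : ℝ) = 1 :=
        le_antisymm (G.sum_mul_sqrt_bet_le hpos hsum r)
          (le_of_mul_le_mul_right (by rwa [one_mul]) hppos)
      have hbet := G.bet_eq_one_of_sum_mul_sqrt_bet hpos hsum hone
      have hr' := hrec r
      simp only [hbet, NNReal.coe_one, Real.sqrt_one, mul_one] at hr'
      have hzero : ∑ a, μ a * (φ p - φ (G.step r a)) = 0 := by
        simp_rw [mul_sub]
        rw [Finset.sum_sub_distrib, ← Finset.sum_mul, hsum, ← hr', hr]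
        ring
      intro a
      refine ⟨hbet a, ?_⟩
      have h2 := (Finset.sum_eq_zero_iff_of_nonneg
        (fun a _ => mul_nonneg (hpos a).le (sub_nonneg.2 (hp _)))).1 hzero a (Finset.mem_univ a)
      have := (mul_eq_zero.1 h2).resolve_left (hpos a).ne'
      linarith
    have hidle : ∀ (w : List A) r, φ r = φ p → G.capitalFrom r w = 1 := by
      intro w
      induction w with
      | nil => intro r _; rfl
      | cons a w ih =>
        intro r hr
        obtain ⟨h1, h2⟩ := hmax r hr a
        rw [capitalFrom, h1, ih _ h2, one_mul]
    have hi : G.Idle p := fun w => hidle w p rfl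
    refine hne (tendsto_nhds_unique (hφ p) ?_)
    simp [G.meanActiveRoot_of_idle hi]
  have hq0 : φ q = 0 := le_antisymm (hp0 ▸ hp q) (hnonneg q)
  exact hq0 ▸ hφ q

end Decrease

end Gambler

/-- A real sequence whose increments are bounded above, and whose increments over `m` steps have
negative mean, decreases at least linearly. -/
theorem exists_le_sub_mul_of_average {ℓ h : ℕ → ℝ} {m : ℕ} {K x : ℝ} (hm : 0 < m) (hK : 0 ≤ K)
    (hstep : ∀ i, ℓ (i + 1) ≤ ℓ i + K) (hjump : ∀ i, ℓ (i + m) ≤ ℓ i + h i) (hx : x < 0)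
    (hh : Filter.Tendsto (fun n : ℕ => (∑ i ∈ Finset.range n, h i) / (n : ℝ)) Filter.atTop
      (nhds x)) :
    ∃ C κ : ℝ, 0 < κ ∧ ∀ n : ℕ, ℓ n ≤ C - κ * n := by
  -- Shifting a block of `m` terms by one replaces `ℓ n` with `ℓ (n + m)`, so the jumps telescope.
  have hsum : ∀ n, ∑ j ∈ Finset.range m, ℓ (n + j) ≤
      ∑ j ∈ Finset.range m, ℓ j + ∑ i ∈ Finset.range n, h i := by
    intro n
    induction n with
    | zero => simp
    | succ n ih =>
      have h1 := Finset.sum_range_succ (fun j => ℓ (n + j)) m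
      have h2 := Finset.sum_range_succ' (fun j => ℓ (n + j)) m
      have h3 : ∑ j ∈ Finset.range m, ℓ (n + 1 + j) = ∑ j ∈ Finset.range m, ℓ (n + (j + 1)) :=
        Finset.sum_congr rfl fun j _ => by rw [add_assoc, add_comm 1 j]
      rw [Finset.sum_range_succ, h3]
      have := hjump n
      simp only [add_zero] at h2
      linarith
  have hsteps : ∀ i d, ℓ (i + d) ≤ ℓ i + K * d := by
    intro i d
    induction d with
    | zero => simp
    | succ d ih =>
      have := hstep (i + d)
      rw [← add_assoc]
      push_cast
      linarith
  -- The one-step bound passes from block sums back to a single term.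
  have hlow : ∀ n, (m : ℝ) * (ℓ (n + m) - K * m) ≤ ∑ j ∈ Finset.range m, ℓ (n + j) := by
    intro n
    have : ∀ j ∈ Finset.range m, ℓ (n + m) - K * m ≤ ℓ (n + j) := by
      intro j hj
      have hj := Finset.mem_range.1 hj
      have h1 := hsteps (n + j) (m - j)
      rw [show n + j + (m - j) = n + m by omega] at h1
      have h2 : ((m - j : ℕ) : ℝ) ≤ m := by exact_mod_cast Nat.sub_le m j
      have h3 := mul_le_mul_of_nonneg_left h2 hK
      linarith
    simpa using Finset.card_nsmul_le_sum _ _ _ this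
  have hmR : (0 : ℝ) < m := by exact_mod_cast hm
  -- Block sums eventually decrease at slope at least `-x / 2`; the division by `m` accounts for the
  -- size of a block.
  set κ : ℝ := -x / 2 / m with hκ
  have hκpos : 0 < κ := div_pos (by linarith) hmR
  set S := ∑ j ∈ Finset.range m, ℓ j with hS
  set B : ℝ := S / m + K * m + κ * m with hB
  have hev : ∀ᶠ n : ℕ in Filter.atTop, ℓ (n + m) + κ * ((n + m : ℕ) : ℝ) ≤ B := by
    filter_upwards [hh.eventually (gt_mem_nhds (show x < x / 2 by linarith)),
      Filter.eventually_gt_atTop 0] with n hn hn0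
    have hnR : (0 : ℝ) < n := by exact_mod_cast hn0
    rw [div_lt_iff₀ hnR] at hn
    have h1 := (hlow n).trans (hsum n)
    have h2 : (m : ℝ) * (ℓ (n + m) + κ * ((n + m : ℕ) : ℝ)) ≤ m * B := by
      have e1 : (m : ℝ) * κ = -x / 2 := by rw [hκ]; field_simp
      have e2 : (m : ℝ) * B = S + m * (K * m) + m * κ * m := by
        rw [hB]; field_simp
      rw [e2, e1]
      push_cast
      have e3 : (m : ℝ) * (ℓ (n + m) + κ * (n + m)) = m * ℓ (n + m) + m * κ * (n + m) := by ring
      rw [e3, e1]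
      linarith
    exact le_of_mul_le_mul_left h2 hmR
  have hbdd : Filter.IsBoundedUnder (· ≤ ·) Filter.atTop (fun n : ℕ => ℓ n + κ * n) := by
    refine ⟨B, Filter.eventually_map.2 ?_⟩
    obtain ⟨N, hN⟩ := Filter.eventually_atTop.1 hev
    refine Filter.eventually_atTop.2 ⟨N + m, fun n hn => ?_⟩
    have := hN (n - m) (by omega)
    rwa [show n - m + m = n by omega] at this
  obtain ⟨C, hC⟩ := hbdd.bddAbove_range
  refine ⟨C, κ, hκpos, fun n => ?_⟩
  have : ℓ n + κ * n ≤ C := hC ⟨n, rfl⟩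
  linarith

/-! ### The capital along a normal sequence -/

namespace Gambler

section Decrease

variable {A Q : Type*} [Fintype A] {μ : A → ℝ} (G : Gambler A Q μ)

theorem capital_add (X : ℕ → A) (n m : ℕ) :
    G.capital (firstLetters X (n + m)) = G.capital (firstLetters X n) *
      G.capitalFrom (G.run G.init (firstLetters X n)) (firstLetters (fun j => X (n + j)) m) := by
  rw [firstLetters_add, capital, capitalFrom_append, capital]

theorem capitalUltimatelyConstant_or_decreasesExponentially [DecidableEq A] [Finite Q]
    (hpos : ∀ a, 0 < μ a) (hsum : ∑ a, μ a = 1) {X : ℕ → A} (hX : IsNormal μ X) :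
    G.CapitalUltimatelyConstant X ∨ G.CapitalDecreasesExponentially X := by
  have := Fintype.ofFinite Q
  by_cases hidle : ∃ n, G.Idle (G.run G.init (firstLetters X n))
  · obtain ⟨N, hN⟩ := hidle
    refine Or.inl ⟨N, fun n hn => ?_⟩
    obtain ⟨d, rfl⟩ := Nat.exists_eq_add_of_le hn
    rw [capital_add, hN, mul_one]
  -- A ruined gambler stays at 0; excluding this makes the logarithms below meaningful.
  by_cases hzero : ∃ n, G.capital (firstLetters X n) = 0
  · obtain ⟨N, hN⟩ := hzero
    refine Or.inl ⟨N, fun n hn => ?_⟩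
    obtain ⟨d, rfl⟩ := Nat.exists_eq_add_of_le hn
    rw [capital_add, hN, zero_mul]
  push Not at hidle hzero
  right
  have hlim : Filter.Tendsto (fun n => ∑ q, G.meanActiveRoot n q) Filter.atTop (nhds 0) := by
    simpa using tendsto_finsetSum Finset.univ
      fun q _ => G.tendsto_meanActiveRoot hpos hsum q
  obtain ⟨m, hm, hm0⟩ := ((hlim.eventually (gt_mem_nhds (zero_lt_one))).and
    (Filter.eventually_gt_atTop 0)).exists
  set c : ℕ → ℝ := fun n => G.capital (firstLetters X n) with hc
  have hcpos : ∀ n, 0 < c n := fun n => by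
    have := pos_iff_ne_zero.2 (hzero n)
    exact_mod_cast this
  set win : ℕ → List A := fun i => firstLetters (fun j => X (i + j)) m with hwin
  -- Summing over all states bounds the term of the current state by a function of the window alone,
  -- to which normality applies.
  have hjump : ∀ i, Real.log (√(c (i + m))) ≤
      Real.log (√(c i)) + (∑ q, G.activeRoot q (win i) - 1) := by
    intro i
    have h1 : √(c (i + m)) = √(c i) *
        G.activeRoot (G.run G.init (firstLetters X i)) (win i) := by
      have hrun : G.run (G.run G.init (firstLetters X i)) (win i) =
          G.run G.init (firstLetters X (i + m)) := by
        rw [firstLetters_add]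
        simp [run, hwin]
      rw [activeRoot, hrun, if_neg (hidle _), ← Real.sqrt_mul (hcpos i).le]
      simp only [hc, capital_add, NNReal.coe_mul, hwin]
    have h2 : 0 < √(c (i + m)) := Real.sqrt_pos.2 (hcpos _)
    have h3 : 0 < √(c i) := Real.sqrt_pos.2 (hcpos _)
    have h4 : 0 < G.activeRoot (G.run G.init (firstLetters X i)) (win i) := by
      rw [h1] at h2
      exact pos_of_mul_pos_right h2 h3.le
    rw [h1, Real.log_mul h3.ne' h4.ne']
    have h5 := Real.log_le_sub_one_of_pos h4
    have h6 := Finset.single_le_sum (f := fun q => G.activeRoot q (win i))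
      (fun q _ => G.activeRoot_nonneg q _)
      (Finset.mem_univ (G.run G.init (firstLetters X i)))
    linarith
  have hstep : ∀ i, Real.log (√(c (i + 1))) ≤
      Real.log (√(c i)) + ∑ q, ∑ a, √(G.bet q a : ℝ) := by
    intro i
    set q := G.run G.init (firstLetters X i) with hq
    have h1 : √(c (i + 1)) = √(c i) * √(G.bet q (X i) : ℝ) := by
      rw [← Real.sqrt_mul (hcpos i).le]
      simp only [hc, firstLetters_succ, capital_append_singleton, NNReal.coe_mul, hq]
    have h2 : 0 < √(c (i + 1)) := Real.sqrt_pos.2 (hcpos _)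
    have h3 : 0 < √(c i) := Real.sqrt_pos.2 (hcpos _)
    have h4 : 0 < √(G.bet q (X i) : ℝ) := by
      rw [h1] at h2
      exact pos_of_mul_pos_right h2 h3.le
    rw [h1, Real.log_mul h3.ne' h4.ne']
    have h5 := Real.log_le_sub_one_of_pos h4
    have h6 := Finset.single_le_sum (f := fun a => √(G.bet q a : ℝ))
      (fun a _ => Real.sqrt_nonneg _) (Finset.mem_univ (X i))
    have h7 := Finset.single_le_sum (f := fun q => ∑ a, √(G.bet q a : ℝ))
      (fun q _ => Finset.sum_nonneg fun a _ => Real.sqrt_nonneg _) (Finset.mem_univ q)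
    linarith
  have hav : Filter.Tendsto (fun n : ℕ =>
      (∑ i ∈ Finset.range n, (∑ q, G.activeRoot q (win i) - 1)) / (n : ℝ)) Filter.atTop
      (nhds (∑ q, G.meanActiveRoot m q - 1)) := by
    have h1 := hX.tendsto_average m (fun w => ∑ q, G.activeRoot q w)
    have h2 : ∑ v : Fin m → A, wordWeight μ (List.ofFn v) * ∑ q, G.activeRoot q (List.ofFn v) =
        ∑ q, G.meanActiveRoot m q := by
      simp_rw [meanActiveRoot, Finset.mul_sum]
      exact Finset.sum_comm
    rw [h2] at h1
    refine (h1.sub_const 1).congr' ?_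
    filter_upwards [Filter.eventually_gt_atTop 0] with n hn
    have hnR : (n : ℝ) ≠ 0 := by positivity
    rw [Finset.sum_sub_distrib]
    simp only [Finset.sum_const, Finset.card_range, nsmul_eq_mul, mul_one, hwin]
    rw [sub_div, div_self hnR]
  obtain ⟨C, κ, hκ, hbound⟩ := exists_le_sub_mul_of_average (ℓ := fun n => Real.log (√(c n))) hm0
    (Finset.sum_nonneg fun q _ => Finset.sum_nonneg fun a _ => Real.sqrt_nonneg _)
    hstep hjump (by linarith) hav
  -- The factors 2 undo the square root.
  refine ⟨Real.exp (2 * C), Real.exp (-(2 * κ)), Real.exp_pos _, ?_, fun n => ?_⟩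
  · rw [Real.exp_lt_one_iff]
    linarith
  · have h1 : c n ≤ Real.exp (2 * C) * Real.exp (-(2 * κ)) ^ n := by
      rw [← Real.exp_nat_mul, ← Real.exp_add, ← Real.log_le_iff_le_exp (hcpos n)]
      have h2 := hbound n
      rw [Real.log_sqrt (hcpos n).le] at h2
      linarith
    exact h1

end Decrease

/-! ### Betting on the letter after a fixed word -/

section Win

variable {A Q R : Type*} [Fintype A] {μ : A → ℝ}

/-- The gambler with its states renamed along a bijection. -/
def relabel (G : Gambler A Q μ) (e : Q ≃ R) : Gambler A R μ where
  init := e G.init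
  step r a := e (G.step (e.symm r) a)
  bet r a := G.bet (e.symm r) a
  fair r := G.fair (e.symm r)

theorem capitalFrom_relabel (G : Gambler A Q μ) (e : Q ≃ R) (q : Q) (w : List A) :
    (G.relabel e).capitalFrom (e q) w = G.capitalFrom q w := by
  induction w generalizing q with
  | nil => rfl
  | cons a w ih => simp [capitalFrom, relabel, ← ih]

theorem capital_relabel (G : Gambler A Q μ) (e : Q ≃ R) (w : List A) :
    (G.relabel e).capital w = G.capital w :=
  G.capitalFrom_relabel e G.init w

variable [DecidableEq A]

theorem abs_wordBet_le (hpos : ∀ b, 0 < μ b) (hsum : ∑ b, μ b = 1) (a b : A) (ε : ℝ) :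
    |ε * ((if b = a then (μ a)⁻¹ else 0) - 1)| ≤ |ε| / μ a := by
  have h1 : μ a ≤ 1 := hsum ▸ Finset.single_le_sum (fun b _ => (hpos b).le) (Finset.mem_univ a)
  have h2 : 1 ≤ (μ a)⁻¹ := (one_le_inv₀ (hpos a)).2 h1
  rw [abs_mul, div_eq_mul_inv]
  refine mul_le_mul_of_nonneg_left ?_ (abs_nonneg ε)
  rw [abs_le]
  split_ifs <;> constructor <;> linarith

theorem half_le_wordBet (hpos : ∀ b, 0 < μ b) (hsum : ∑ b, μ b = 1) (a b : A) {ε : ℝ}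
    (hε : |ε| ≤ μ a / 2) : 1 / 2 ≤ 1 + ε * ((if b = a then (μ a)⁻¹ else 0) - 1) := by
  have h1 : |ε| / μ a ≤ 1 / 2 := by
    rw [div_le_iff₀ (hpos a)]
    linarith
  have h2 := (abs_le.1 ((abs_wordBet_le hpos hsum a b ε).trans h1)).1
  linarith

/-- The gambler that remembers the last `|u|` letters and, after reading `u`, bets on the next
letter being `a` (against it, if `ε` is negative). -/
noncomputable def wordBettor (hpos : ∀ b, 0 < μ b) (hsum : ∑ b, μ b = 1) (u : List A) (a : A)
    (ε : ℝ) (hε : |ε| ≤ μ a / 2) : Gambler A {l : List A // l.length ≤ u.length} μ where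
  init := ⟨[], by simp⟩
  step q b := ⟨(q.1 ++ [b]).rtake u.length, by simp [List.rtake]; omega⟩
  -- By `hε` the argument is at least 1/2, so `Real.toNNReal` truncates nothing.
  bet q b := if q.1 = u then Real.toNNReal (1 + ε * ((if b = a then (μ a)⁻¹ else 0) - 1)) else 1
  fair q := by
    by_cases hq : q.1 = u
    · have h : ∀ b, μ b * ((Real.toNNReal (1 + ε * ((if b = a then (μ a)⁻¹ else 0) - 1)) : ℝ≥0) :
          ℝ) = (1 - ε) * μ b + ε * (if b = a then μ b * (μ a)⁻¹ else 0) := fun b => by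
        rw [Real.coe_toNNReal _ (by linarith [half_le_wordBet hpos hsum a b hε])]
        split_ifs <;> ring
      simp only [if_pos hq, h]
      rw [Finset.sum_add_distrib, ← Finset.mul_sum, ← Finset.mul_sum, hsum]
      simp [(hpos a).ne']
    · simp [hq, hsum]

variable (hpos : ∀ b, 0 < μ b) (hsum : ∑ b, μ b = 1) (u : List A) (a : A)
  {ε : ℝ} (hε : |ε| ≤ μ a / 2)

theorem run_wordBettor (l : List A) :
    ((wordBettor hpos hsum u a ε hε).run (wordBettor hpos hsum u a ε hε).init l).1 =
      l.rtake u.length := by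
  induction l using List.reverseRecOn with
  | nil => simp [run, wordBettor]
  | append_singleton l b ih =>
    have h : ((wordBettor hpos hsum u a ε hε).run (wordBettor hpos hsum u a ε hε).init
        (l ++ [b])).1 = ((((wordBettor hpos hsum u a ε hε).run
          (wordBettor hpos hsum u a ε hε).init l).1) ++ [b]).rtake u.length := by
      simp only [run, List.foldl_append, List.foldl_cons, List.foldl_nil]
      rfl
    rw [h, ih]
    cases u.length with
    | zero => simp
    | succ k =>
      rw [List.rtake_concat_succ, List.rtake_concat_succ]
      simp [List.rtake_eq_reverse_take_reverse, List.take_take]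

theorem capital_wordBettor_append_singleton (l : List A) (b : A) :
    ((wordBettor hpos hsum u a ε hε).capital (l ++ [b]) : ℝ) =
      (wordBettor hpos hsum u a ε hε).capital l *
        if u <:+ l then 1 + ε * ((if b = a then (μ a)⁻¹ else 0) - 1) else 1 := by
  have hrun := run_wordBettor hpos hsum u a hε l
  rw [capital_append_singleton, NNReal.coe_mul]
  congr 1
  by_cases hs : u <:+ l
  · have h1 := hrun.trans (rtake_length_eq_iff.2 hs)
    simp only [wordBettor] at h1 ⊢
    rw [if_pos h1, if_pos hs, Real.coe_toNNReal _ (by linarith [half_le_wordBet hpos hsum a b hε])]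
  · have h1 := fun h => hs (rtake_length_eq_iff.1 (hrun.symm.trans h))
    simp only [wordBettor] at h1 ⊢
    rw [if_neg h1, if_neg hs, NNReal.coe_one]

theorem capital_wordBettor_pos (l : List A) :
    (0 : ℝ) < (wordBettor hpos hsum u a ε hε).capital l := by
  induction l using List.reverseRecOn with
  | nil => simp [capital_nil]
  | append_singleton l b ih =>
    rw [capital_wordBettor_append_singleton]
    refine mul_pos ih ?_
    by_cases hs : u <:+ l
    · rw [if_pos hs]
      linarith [half_le_wordBet hpos hsum a b hε]
    · rw [if_neg hs]
      exact one_pos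

/-- The excess of the occurrences of `u ++ [a]` in `l`, divided by `μ a`, over the occurrences of
`u` that are followed by a letter. -/
noncomputable def excess (μ : A → ℝ) (u : List A) (a : A) (l : List A) : ℝ :=
  nbocc (u ++ [a]) l * (μ a)⁻¹ - (nbocc u l - if u <:+ l then 1 else 0)

/-- From `1 - (1 + x)⁻¹ ≤ log (1 + x)`; the slack has numerator `x ^ 2 * (2 * x + 1)`, which needs
`x ≥ -1/2`. -/
theorem sub_le_log_one_add {x : ℝ} (hx : 1 / 2 ≤ 1 + x) : x - 2 * x ^ 2 ≤ Real.log (1 + x) := by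
  refine le_trans ?_ (Real.one_sub_inv_le_log_of_pos (by linarith))
  have h : 1 - (1 + x)⁻¹ - (x - 2 * x ^ 2) = x ^ 2 * (2 * x + 1) / (1 + x) := by
    have : 1 + x ≠ 0 := by linarith
    field_simp
    ring
  have : 0 ≤ x ^ 2 * (2 * x + 1) / (1 + x) :=
    div_nonneg (mul_nonneg (sq_nonneg x) (by linarith)) (by linarith)
  linarith

/-- The first-order terms of the active bets add up exactly to `ε` times the excess, and each
second-order loss is at most `2 * (|ε| / μ a) ^ 2`. -/
theorem le_log_capital_wordBettor (l : List A) :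
    ε * excess μ u a l - 2 * (|ε| / μ a) ^ 2 * l.length ≤
      Real.log ((wordBettor hpos hsum u a ε hε).capital l) := by
  induction l using List.reverseRecOn with
  | nil => simp [capital_nil, excess, nbocc_nil]
  | append_singleton l b ih =>
    have hcap := capital_wordBettor_pos hpos hsum u a hε l
    have hB : 0 ≤ 2 * (|ε| / μ a) ^ 2 := by positivity
    have hex : excess μ u a (l ++ [b]) = excess μ u a l +
        if u <:+ l then (if b = a then (μ a)⁻¹ else 0) - 1 else 0 := by
      simp only [excess, nbocc_append_singleton, append_singleton_suffix_append_singleton,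
        eq_comm (a := a)]
      by_cases h1 : u <:+ l <;> by_cases h2 : b = a <;> simp [h1, h2] <;> ring
    rw [capital_wordBettor_append_singleton, hex, List.length_append, List.length_singleton]
    push_cast
    by_cases hs : u <:+ l
    · rw [if_pos hs, if_pos hs]
      have hbet := half_le_wordBet hpos hsum a b hε
      rw [Real.log_mul hcap.ne' (by linarith)]
      have h1 := sub_le_log_one_add hbet
      have h2 := sq_le_sq' (abs_le.1 (abs_wordBet_le hpos hsum a b ε)).1
        (abs_le.1 (abs_wordBet_le hpos hsum a b ε)).2
      nlinarith
    · rw [if_neg hs, if_neg hs]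
      rw [mul_one, add_zero]
      linarith

end Win

/-! ### From exponential lower bounds to winning rates -/

section Exponential

variable {A Q : Type*} [Fintype A] {μ : A → ℝ} {G : Gambler A Q μ} {X : ℕ → A} {κ : ℝ}

theorem wins_of_frequently (hκ : 0 < κ) (h : ∃ᶠ n : ℕ in Filter.atTop,
      Real.exp (κ * n) ≤ G.capital (firstLetters X n)) : G.Wins X := by
  rw [Wins, eq_top_iff]
  refine ENNReal.le_of_forall_nnreal_lt fun r _ => ?_
  refine Filter.le_limsup_of_frequently_le' ?_
  have ht : Filter.Tendsto (fun n : ℕ => Real.exp (κ * n)) Filter.atTop Filter.atTop :=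
    Real.tendsto_exp_atTop.comp (tendsto_natCast_atTop_atTop.const_mul_atTop hκ)
  refine (h.and_eventually (ht.eventually_ge_atTop (r : ℝ))).mono fun n hn => ?_
  have h1 : r ≤ G.capital (firstLetters X n) := by exact_mod_cast hn.2.trans hn.1
  exact_mod_cast h1

theorem hasIOExponentialRate_of_frequently (hκ : 0 < κ) (h : ∃ᶠ n : ℕ in Filter.atTop,
      Real.exp (κ * n) ≤ G.capital (firstLetters X n)) : G.HasIOExponentialRate X := by
  have h0 : (0 : EReal) < (κ : EReal) := by exact_mod_cast hκ
  refine h0.trans_le (Filter.le_limsup_of_frequently_le' ?_)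
  refine (h.and_eventually (Filter.eventually_gt_atTop 0)).mono fun n hn => ?_
  obtain ⟨h1, hn0⟩ := hn
  have hnR : (0 : ℝ) < n := by exact_mod_cast hn0
  have hc : (0 : ℝ) < G.capital (firstLetters X n) := (Real.exp_pos _).trans_le h1
  have hc' : G.capital (firstLetters X n) ≠ 0 := fun h => by simp [h] at hc
  rw [ENNReal.log_of_nnreal hc', ← EReal.coe_div, EReal.coe_le_coe_iff, le_div_iff₀ hnR]
  exact (Real.le_log_iff_exp_le hc).2 h1

end Exponential

end Gambler

/-! ### A winning gambler against a sequence that is not normal -/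

section NotNormal

variable {A : Type*} [DecidableEq A] {μ : A → ℝ} {X : ℕ → A}

/-- In a sequence that is not normal, some word has the right frequency while one of its
extensions by a letter has not. -/
theorem exists_extension_of_not_isNormal (hX : ¬ IsNormal μ X) : ∃ (u : List A) (a : A),
    Filter.Tendsto (fun n : ℕ => freq u (firstLetters X n)) Filter.atTop (nhds (wordWeight μ u)) ∧
    ¬ Filter.Tendsto (fun n : ℕ => freq (u ++ [a]) (firstLetters X n)) Filter.atTop
      (nhds (wordWeight μ (u ++ [a]))) := by
  by_contra! h
  refine hX fun w => ?_
  induction w using List.reverseRecOn with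
  | nil =>
    have : ∀ n : ℕ, freq ([] : List A) (firstLetters X n) = 1 := fun n => by
      have : (n : ℝ) + 1 ≠ 0 := by positivity
      simp [freq, nbocc, firstLetters_length, this]
    simp [this, wordWeight]
  | append_singleton u a ih => exact h u a ih

/-- If the excess were `o(n)`, the frequency of `u` would force that of `u ++ [a]`. The sign `s` is
one that occurs infinitely often. -/
theorem exists_frequently_excess (hpos : ∀ a, 0 < μ a) (hX : ¬ IsNormal μ X) :
    ∃ (u : List A) (a : A) (η s : ℝ), 0 < η ∧ |s| = 1 ∧ ∃ᶠ n : ℕ in Filter.atTop,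
      η * n ≤ s * Gambler.excess μ u a (firstLetters X n) := by
  obtain ⟨u, a, hu, hua⟩ := exists_extension_of_not_isNormal hX
  refine ⟨u, a, ?_⟩
  rw [tendsto_freq_iff] at hu hua
  have hnot : ¬ Filter.Tendsto (fun n : ℕ => Gambler.excess μ u a (firstLetters X n) / n)
      Filter.atTop (nhds 0) := by
    intro h
    apply hua
    have hs : Filter.Tendsto
        (fun n : ℕ => (if u <:+ firstLetters X n then (1 : ℝ) else 0) / n)
        Filter.atTop (nhds 0) := by
      refine squeeze_zero (fun n => ?_) (fun n => ?_) (tendsto_const_div_atTop_nhds_zero_nat 1)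
      · split_ifs <;> positivity
      · gcongr
        split_ifs <;> norm_num
    have h1 := ((h.add hu).sub hs).mul_const (μ a)
    rw [zero_add, sub_zero, ← wordWeight_append_singleton] at h1
    refine h1.congr fun n => ?_
    have := (hpos a).ne'
    rw [Gambler.excess]
    field_simp
    ring
  rw [Metric.tendsto_atTop] at hnot
  push Not at hnot
  obtain ⟨η, hη, hfar⟩ := hnot
  have hfreq : ∃ᶠ n : ℕ in Filter.atTop,
      η * n ≤ 1 * Gambler.excess μ u a (firstLetters X n) ∨
      η * n ≤ -1 * Gambler.excess μ u a (firstLetters X n) := by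
    refine (Filter.frequently_atTop.2 fun N => hfar N).and_eventually
      (Filter.eventually_gt_atTop 0) |>.mono fun n hn => ?_
    obtain ⟨h1, hn0⟩ := hn
    have hnR : (0 : ℝ) < n := by exact_mod_cast hn0
    rw [Real.dist_eq, sub_zero, le_abs, ← neg_div, le_div_iff₀ hnR, le_div_iff₀ hnR] at h1
    simpa using h1
  rcases Filter.frequently_or_distrib.1 hfreq with h | h
  · exact ⟨η, 1, hη, by simp, h⟩
  · exact ⟨η, -1, hη, by simp, h⟩

variable [Fintype A]

theorem exists_winning_gambler (hpos : ∀ a, 0 < μ a) (hsum : ∑ a, μ a = 1)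
    (hX : ¬ IsNormal μ X) : ∃ (Q : Type) (_ : Finite Q) (G : Gambler A Q μ),
      G.Wins X ∧ G.HasIOExponentialRate X := by
  obtain ⟨u, a, η, s, hη, hs, hfreq⟩ := exists_frequently_excess hpos hX
  have ha := hpos a
  -- The first bound keeps the bets legal; the second keeps the quadratic loss within half of the
  -- gain `t * η` per letter.
  set t : ℝ := min (μ a / 2) (η * μ a ^ 2 / 4) with ht
  have ht0 : 0 < t := lt_min (by positivity) (by positivity)
  have habs : |s * t| = t := by rw [abs_mul, hs, one_mul, abs_of_pos ht0]
  have hε : |s * t| ≤ μ a / 2 := habs.trans_le (min_le_left _ _)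
  have : Finite {l : List A // l.length ≤ u.length} := List.finite_length_le A u.length
  -- The words live in the universe of `A`; `Fin k` provides states in `Type`.
  obtain ⟨k, ⟨e⟩⟩ := Finite.exists_equiv_fin {l : List A // l.length ≤ u.length}
  have hrate : ∃ᶠ n : ℕ in Filter.atTop, Real.exp (t * η / 2 * n) ≤
      ((Gambler.wordBettor hpos hsum u a (s * t) hε).relabel e).capital (firstLetters X n) := by
    refine hfreq.mono fun n hn => ?_
    rw [Gambler.capital_relabel,
      ← Real.le_log_iff_exp_le (Gambler.capital_wordBettor_pos hpos hsum u a hε _)]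
    refine le_trans ?_ (Gambler.le_log_capital_wordBettor hpos hsum u a hε _)
    rw [habs, firstLetters_length]
    have h1 : 2 * (t / μ a) ^ 2 ≤ t * η / 2 := by
      have h2 : t ≤ η * μ a ^ 2 / 4 := min_le_right _ _
      rw [div_pow, mul_div_assoc', div_le_iff₀ (by positivity)]
      nlinarith
    have h3 := mul_le_mul_of_nonneg_right h1 n.cast_nonneg
    have h4 := mul_le_mul_of_nonneg_left hn ht0.le
    linarith
  have hκ : 0 < t * η / 2 := by positivity
  exact ⟨Fin k, inferInstance, _, Gambler.wins_of_frequently hκ hrate,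
    Gambler.hasIOExponentialRate_of_frequently hκ hrate⟩

end NotNormal

end SchnorrStimm

theorem mainTheorem4 {A : Type*} [Fintype A] [DecidableEq A]
    (μ : A → ℝ) (hμ_pos : ∀ a : A, 0 < μ a) (hμ_sum : ∑ a : A, μ a = 1) (X : ℕ → A) :
    (SchnorrStimm.IsNormal μ X →
      ∀ (Q : Type*) [Finite Q] (G : SchnorrStimm.Gambler A Q μ),
        G.CapitalUltimatelyConstant X ∨ G.CapitalDecreasesExponentially X) ∧
    (¬ SchnorrStimm.IsNormal μ X →
      ∃ (Q : Type) (_ : Finite Q) (G : SchnorrStimm.Gambler A Q μ),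
        G.Wins X ∧ G.HasIOExponentialRate X) :=
  ⟨fun hX _ _ G => G.capitalUltimatelyConstant_or_decreasesExponentially hμ_pos hμ_sum hX,
    SchnorrStimm.exists_winning_gambler hμ_pos hμ_sum⟩
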